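/- Let $d\ge 1$, let $V$ be a $d\times d$ real symmetric positive definite matrix with all diagonal entries equal to $1$, and let $\lambda_{\min}$ and $\lambda_{\max}$ be its smallest and largest eigenvalues. Let $(e_i)_{i\in\mathbb Z}$ be i.i.d. random vectors, each uniformly distributed on the set of the $d$ standard basis (column) vectors of $\mathbb R^d$, and let $(g_i)_{i\in\mathbb Z}$ be i.i.d. standard Gaussian random variables, independent of $(e_i)_{i\in\mathbb Z}$. For $m\ge 0$ define the chain $(X_{i,m})_{i\ge -m}$ by $$X_{-m,m}=0,\qquad X_{i+1,m}=X_{i,m}+(g_i-e_i^{T}X_{i,m})\,(Ve_i),\quad i\ge -m,$$ and put $X_i=X_{i,0}$ for $i\ge 0$. Let $\hat\kappa>0$ and $0<\hat\gamma\le 1$, and let $f:\mathbb R^d\to\mathbb R$ be a Borel function such that $$E\big((f(X)-f(X'))^2\big)\le \hat\kappa^2\,\big(E\|X-X'\|^2\big)^{\hat\gamma}$$ for every (possibly degenerate) centered Gaussian vector $(X,X')$ in $\mathbb R^d\times\mathbb R^d$ with $\mathrm{cov}(X)\le V$ and $\mathrm{cov}(X')\le V$ in the Loewner order, where $\|\cdot\|$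 is the Euclidean norm. For $i\ge 0$ set $$\nu(i)=\hat\kappa^2\min\Big((\lambda_{\max}d)^{\hat\gamma}\Big(1-\frac{\lambda_{\min}}{d}\Big)^{\hat\gamma i},\ \Big(\frac{d^2}{i+1}\Big)^{\hat\gamma}\Big),$$ with the convention $0^0=1$. If $d\ge 2$, then Assumption A1 holds for $f$ with this $\nu$; that is, $f(X_i)$ is square-integrable for all $i\ge0$, the sequence $(\nu(i))_{i\ge 0}$ is positive and strictly decreasing, $$\sum_{i=0}^\infty\sqrt{\frac{\nu(i)}{i+1}}<\infty ,\qquad\text{and}\qquad E\big((f(X_{i,m})-f(X_i))^2\big)\le \nu(i)\quad\text{for all } i,m\ge 0 .$$ If $d=1$, the same conclusions hold except that $\nu$ is only nonnegative and nonincreasing. -/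

import Mathlib

open MeasureTheory ProbabilityTheory

noncomputable section

/-- `iterMap g i x u` is the state reached from `x` after `i` steps driven by
`u 0, …, u (i - 1)`, i.e. `G_i(x; u_0, …, u_{i-1})`, with
`G_0(x) = x` and `G_{i+1}(x; u_0, …, u_i) = g(G_i(x; u_0, …, u_{i-1}), u_i)`. -/
def iterMap {F F' : Type*} (g : F → F' → F) : ℕ → F → (ℕ → F') → F
  | 0, x, _ => x
  | i + 1, x, u => g (iterMap g i x u) (u i)

/-- The shifted chain `X_{i,m} = G_{i+m}(x₀; U_{-m}, U_{-m+1}, …, U_{i-1})` for `i, m ≥ 0`: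
the chain starts at `x₀` at time `-m` and is observed at time `i`. For `m = 0` it is `X_i`. -/
def shiftedChain {Ω F F' : Type*} (g : F → F' → F) (x₀ : F) (U : ℤ → Ω → F')
    (i m : ℕ) (ω : Ω) : F :=
  iterMap g (i + m) x₀ (fun n => U ((n : ℤ) - (m : ℤ)) ω)

/-- The coupling bound for the chain with transition map `g`, deterministic initial value `x₀`
and driving sequence `U`, with a rate `ν` which is only asked to be nonnegative and
nonincreasing. -/
structure CouplingBound {Ω F F' : Type*} [MeasurableSpace Ω] (P : Measure Ω)
    (g : F → F' → F) (x₀ : F) (U : ℤ → Ω → F') (f : F → ℝ) (ν : ℕ → ℝ) : Prop where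
  /-- `f(X_i)` is square-integrable. -/
  memLp : ∀ i : ℕ, MemLp (fun ω => f (shiftedChain g x₀ U i 0 ω)) 2 P
  nonneg : ∀ i : ℕ, 0 ≤ ν i
  antitone : Antitone ν
  /-- `∑ √(ν(i) / (i + 1)) < ∞`. -/
  summable : Summable fun i : ℕ => Real.sqrt (ν i / ((i : ℝ) + 1))
  /-- `E((f(X_{i,m}) - f(X_i))²) ≤ ν(i)`; as a lower integral, so that finiteness is included. -/
  sq_le : ∀ i m : ℕ,
    ∫⁻ ω, ENNReal.ofReal
        ((f (shiftedChain g x₀ U i m ω) - f (shiftedChain g x₀ U i 0 ω)) ^ 2) ∂P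
      ≤ ENNReal.ofReal (ν i)

/-- Assumption A1: the coupling bound holds with a positive (strictly) decreasing sequence `ν`. -/
structure AssumptionA1 {Ω F F' : Type*} [MeasurableSpace Ω] (P : Measure Ω)
    (g : F → F' → F) (x₀ : F) (U : ℤ → Ω → F') (f : F → ℝ) (ν : ℕ → ℝ) : Prop
    extends CouplingBound P g x₀ U f ν where
  pos : ∀ i : ℕ, 0 < ν i
  strictAnti : StrictAnti ν

/-- The transition map `x ↦ x + (g' - e'ᵀ x) (V e')` driven by the pair `(g', e')`. -/
def gaussianUpdate {d : ℕ} (V : Matrix (Fin d) (Fin d) ℝ) (x : EuclideanSpace ℝ (Fin d))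
    (u : ℝ × EuclideanSpace ℝ (Fin d)) : EuclideanSpace ℝ (Fin d) :=
  x + (u.1 - inner ℝ u.2 x) • WithLp.toLp 2 (V.mulVec u.2.ofLp)

/-- The law of the random vector whose `j`-th coordinate is `1` and whose other coordinates are
`0`, where `j` is uniform on the `d` coordinates. -/
def uniformBasisLaw (d : ℕ) : Measure (EuclideanSpace ℝ (Fin d)) :=
  (d : ENNReal)⁻¹ • ∑ j : Fin d, Measure.dirac (EuclideanSpace.single j (1 : ℝ))

/-- The covariance matrix of a law on `ℝ^d`. -/
def covMatrix {d : ℕ} (μ : Measure (EuclideanSpace ℝ (Fin d))) : Matrix (Fin d) (Fin d) ℝ :=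
  Matrix.of fun i j => covariance (fun x => x i) (fun x => x j) μ

/-- `μ`, the joint law of a pair `(X, X')` of `d`-dimensional vectors, is centered Gaussian
(possibly degenerate) with `cov(X) ≤ V` and `cov(X') ≤ V` in the Loewner order. -/
structure IsGaussianPairBelow {d : ℕ} (V : Matrix (Fin d) (Fin d) ℝ)
    (μ : Measure (EuclideanSpace ℝ (Fin d) × EuclideanSpace ℝ (Fin d))) : Prop where
  isGaussian : IsGaussian μ
  centered : ∫ p, p ∂μ = 0
  cov_fst_le : (V - covMatrix (μ.map Prod.fst)).PosSemidef
  cov_snd_le : (V - covMatrix (μ.map Prod.snd)).PosSemidef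

/-- `E((f(X) - f(X'))²) ≤ κ² (E‖X - X'‖²)^γ` for every centered Gaussian pair `(X, X')` with
`cov(X) ≤ V` and `cov(X') ≤ V`. -/
def GaussianHolder {d : ℕ} (V : Matrix (Fin d) (Fin d) ℝ) (κ γ : ℝ)
    (f : EuclideanSpace ℝ (Fin d) → ℝ) : Prop :=
  ∀ μ : Measure (EuclideanSpace ℝ (Fin d) × EuclideanSpace ℝ (Fin d)),
    IsGaussianPairBelow V μ →
      ∫⁻ p, ENNReal.ofReal ((f p.1 - f p.2) ^ 2) ∂μ
        ≤ ENNReal.ofReal (κ ^ 2 * (∫ p, ‖p.1 - p.2‖ ^ 2 ∂μ) ^ γ)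

/-- `ν(i) = κ² min((λ_max d)^γ (1 - λ_min/d)^{γ i}, (d²/(i+1))^γ)`. -/
def gaussianRate (d : ℕ) (lamMin lamMax κ γ : ℝ) (i : ℕ) : ℝ :=
  κ ^ 2 * min ((lamMax * (d : ℝ)) ^ γ * (1 - lamMin / (d : ℝ)) ^ (γ * (i : ℝ)))
    (((d : ℝ) ^ 2 / ((i : ℝ) + 1)) ^ γ)

end

/-! Fix the directions `e`. The chain is then a linear combination of the Gaussian innovations, so
`X_{i,m}` and `X_i` form a centered Gaussian pair. Since `V` has unit diagonal, a step with matrix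
`P = 1 - V e eᵀ` satisfies `P V Pᵀ + (Ve)(Ve)ᵀ = V`, so covariances started at `0` stay below `V`.
Innovations from time `0` on cancel in the difference, which is `Q X_{0,m}` with `Q` the product of
`i` step matrices; its conditional second moment is at most `tr (Q V Qᵀ)`. The Hölder hypothesis,
Fubini and Jensen for `t ↦ t^γ` reduce the claim to bounding `E tr (Q V Qᵀ)`, and by independence of
the directions this is `tr (Tⁱ V)` with `T = averagedStep V`.

Everything then rests on `tr (V⁻¹ T M) = tr (V⁻¹ M) - tr M / d` (`trace_inv_mul_averagedStep`).
Bounding `tr M` below by `λ_min tr (V⁻¹ M)` makes `tr (V⁻¹ Tⁱ V)` decay geometrically from its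
initial value `d`. Telescoping instead gives `∑ tr (Tᵏ V) ≤ d²`, and the summands are nonincreasing
because `T V ≤ V`, whence `d² / (i + 1)`. For `d = 1` the ratio `1 - λ_min / d` is `0`, so the rate
vanishes for `i ≥ 1` and strictness is lost. -/

/-- The linear part `1 - V y yᵀ` of the transition map. -/
def stepMatrix {d : ℕ} (V : Matrix (Fin d) (Fin d) ℝ) (y : Fin d → ℝ) :
    Matrix (Fin d) (Fin d) ℝ :=
  1 - V * Matrix.vecMulVec y y

/-- The average of `P M Pᵀ` over the step matrices `P` of the standard basis vectors. -/
noncomputable def averagedStep {d : ℕ} (V M : Matrix (Fin d) (Fin d) ℝ) :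
    Matrix (Fin d) (Fin d) ℝ :=
  (d : ℝ)⁻¹ • ∑ j, stepMatrix V (Pi.single j 1) * M * (stepMatrix V (Pi.single j 1)).transpose

/-! ### Trace decay under the averaged step. -/

section LinearAlgebra

open Matrix Finset

variable {d : ℕ} {V : Matrix (Fin d) (Fin d) ℝ}

lemma vecMulVec_mul_mul_vecMulVec_single (hdiag : ∀ j, V j j = 1) (j : Fin d) :
    vecMulVec (Pi.single j 1) (Pi.single j 1) * V *
      vecMulVec (Pi.single j 1) (Pi.single j 1) =
      vecMulVec (Pi.single j 1) (Pi.single j (1 : ℝ)) := by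
  rw [vecMulVec_mul, vecMulVec_mul_vecMulVec]
  simp [hdiag]

lemma transpose_stepMatrix (hV : V.transpose = V) (y : Fin d → ℝ) :
    (stepMatrix V y).transpose = 1 - vecMulVec y y * V := by
  simp [stepMatrix, hV, transpose_vecMulVec]

/-- The subtracted term is the covariance of the fresh innovation, so `V` is invariant under a full
step. The unit diagonal enters through `D V D = D` for `D = e_j e_jᵀ`. -/
lemma stepMatrix_mul_mul_transpose (hV : V.transpose = V) (hdiag : ∀ j, V j j = 1) (j : Fin d) :
    stepMatrix V (Pi.single j 1) * V * (stepMatrix V (Pi.single j 1)).transpose =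
      V - vecMulVec (V *ᵥ Pi.single j 1) (V *ᵥ Pi.single j 1) := by
  have h := vecMulVec_mul_mul_vecMulVec_single hdiag j
  have h2 : vecMulVec (V *ᵥ Pi.single j 1) (V *ᵥ Pi.single j 1) =
      V * vecMulVec (Pi.single j 1) (Pi.single j 1) * V := by
    rw [mul_vecMulVec, vecMulVec_mul, ← mulVec_transpose, hV]
  rw [transpose_stepMatrix hV, h2, stepMatrix]
  generalize vecMulVec (Pi.single j 1) (Pi.single j (1 : ℝ)) = D at *
  have : (1 - V * D) * V * (1 - D * V) = V - V * D * V - V * D * V + V * (D * V * D) * V := by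
    noncomm_ring
  rw [this, h]
  abel

lemma posSemidef_vecMulVec_self (a : Fin d → ℝ) : (vecMulVec a a).PosSemidef := by
  simpa using posSemidef_vecMulVec_self_star a

lemma posSemidef_mul_mul_transpose {M : Matrix (Fin d) (Fin d) ℝ} (hM : M.PosSemidef)
    (B : Matrix (Fin d) (Fin d) ℝ) : (B * M * B.transpose).PosSemidef := by
  simpa using hM.mul_mul_conjTranspose_same B

lemma averagedStep_posSemidef {M : Matrix (Fin d) (Fin d) ℝ} (hM : M.PosSemidef) :
    (averagedStep V M).PosSemidef :=
  (posSemidef_sum _ fun _ _ => posSemidef_mul_mul_transpose hM _).smul (by positivity)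

lemma averagedStep_sub (M N : Matrix (Fin d) (Fin d) ℝ) :
    averagedStep V (M - N) = averagedStep V M - averagedStep V N := by
  simp only [averagedStep, mul_sub, sub_mul, sum_sub_distrib, smul_sub]

lemma averagedStep_iterate_posSemidef (hV : V.PosSemidef) (n : ℕ) :
    ((averagedStep V)^[n] V).PosSemidef := by
  induction n with
  | zero => simpa
  | succ n ih =>
    rw [Function.iterate_succ_apply']
    exact averagedStep_posSemidef ih

/-- `V - T V` is an average of rank-one positive matrices, and `T` is linear and preserves
positivity. -/
lemma averagedStep_iterate_sub_posSemidef [NeZero d] (hV : V.transpose = V)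
    (hdiag : ∀ j, V j j = 1) (n : ℕ) :
    ((averagedStep V)^[n] V - (averagedStep V)^[n + 1] V).PosSemidef := by
  induction n with
  | zero =>
    have hd : (d : ℝ) ≠ 0 := by exact_mod_cast NeZero.ne d
    have : V - averagedStep V V =
        (d : ℝ)⁻¹ • ∑ j, vecMulVec (V *ᵥ Pi.single j 1) (V *ᵥ Pi.single j 1) := by
      simp only [averagedStep, stepMatrix_mul_mul_transpose hV hdiag, sum_sub_distrib, smul_sub,
        sum_const, card_univ, Fintype.card_fin]
      rw [← Nat.cast_smul_eq_nsmul ℝ, smul_smul, inv_mul_cancel₀ hd]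
      simp
    simp only [Function.iterate_zero, id, zero_add, Function.iterate_one, this]
    exact (posSemidef_sum _ fun _ _ => posSemidef_vecMulVec_self _).smul (by positivity)
  | succ n ih =>
    rw [Function.iterate_succ_apply', Function.iterate_succ_apply' _ (n + 1), ← averagedStep_sub]
    exact averagedStep_posSemidef ih

/-- By cyclicity it suffices that `Pᵀ V⁻¹ P = V⁻¹ - D` for each basis direction, which again follows
from `D V D = D`; averaging `tr (D M) = M j j` over `j` gives `tr M / d`. -/
lemma trace_inv_mul_averagedStep [NeZero d] (hV : V.PosDef) (hdiag : ∀ j, V j j = 1)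
    (M : Matrix (Fin d) (Fin d) ℝ) :
    (V⁻¹ * averagedStep V M).trace = (V⁻¹ * M).trace - M.trace / d := by
  have hd : (d : ℝ) ≠ 0 := by exact_mod_cast NeZero.ne d
  have hVt : V.transpose = V := by simpa using hV.isHermitian.eq
  have hu : IsUnit V.det := (isUnit_iff_isUnit_det _).1 hV.isUnit
  have key (j : Fin d) : (V⁻¹ * (stepMatrix V (Pi.single j 1) * M *
      (stepMatrix V (Pi.single j 1)).transpose)).trace = (V⁻¹ * M).trace - M j j := by
    have h := vecMulVec_mul_mul_vecMulVec_single hdiag j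
    have h2 : (vecMulVec (Pi.single j 1) (Pi.single j (1 : ℝ)) * M).trace = M j j := by
      rw [vecMulVec_mul, trace_vecMulVec]
      simp
    rw [← h2, ← mul_assoc, trace_mul_comm, ← mul_assoc, ← mul_assoc, transpose_stepMatrix hVt,
      stepMatrix, ← trace_sub, ← sub_mul]
    generalize vecMulVec (Pi.single j 1) (Pi.single j (1 : ℝ)) = D at *
    congr 2
    have : (1 - D * V) * V⁻¹ * (1 - V * D) =
        V⁻¹ - (V⁻¹ * V) * D - D * (V * V⁻¹) + D * (V * V⁻¹) * V * D := by noncomm_ring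
    rw [this, nonsing_inv_mul _ hu, mul_nonsing_inv _ hu, mul_one, one_mul, h]
    abel
  rw [averagedStep, mul_smul_comm, trace_smul, mul_sum, trace_sum]
  simp only [key, sum_sub_distrib, sum_const, card_univ, Fintype.card_fin, nsmul_eq_mul,
    smul_eq_mul]
  rw [show ∑ j, M j j = M.trace from rfl]
  field_simp

open scoped MatrixOrder in
lemma trace_mul_nonneg_of_posSemidef {A M : Matrix (Fin d) (Fin d) ℝ} (hA : A.PosSemidef)
    (hM : M.PosSemidef) : 0 ≤ (A * M).trace := by
  obtain ⟨B, hB⟩ := CStarAlgebra.nonneg_iff_eq_star_mul_self.1 hA.nonneg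
  rw [star_eq_conjTranspose] at hB
  subst hB
  rw [mul_assoc, trace_mul_comm]
  exact (hM.mul_mul_conjTranspose_same B).trace_nonneg

lemma hasEigenvalue_eigenvalues (hV : V.IsHermitian) (j : Fin d) :
    Module.End.HasEigenvalue (toLin' V) (hV.eigenvalues j) := by
  rw [Module.End.hasEigenvalue_iff_mem_spectrum, spectrum_toLin']
  exact hV.eigenvalues_mem_spectrum_real j

lemma exists_unitary_diagonal (hV : V.PosDef) (a b : ℝ) :
    ∃ U : Matrix (Fin d) (Fin d) ℝ, a • (1 : Matrix (Fin d) (Fin d) ℝ) + b • V⁻¹ =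
      U * diagonal (fun j => a + b * (hV.isHermitian.eigenvalues j)⁻¹) * Uᴴ := by
  set U : Matrix (Fin d) (Fin d) ℝ := (hV.isHermitian.eigenvectorUnitary).1 with hU
  have hUU : U * Uᴴ = 1 := by
    rw [← star_eq_conjTranspose]; exact Unitary.coe_mul_star_self _
  have hUU' : Uᴴ * U = 1 := mul_eq_one_comm.1 hUU
  have hs : V = U * diagonal hV.isHermitian.eigenvalues * Uᴴ := by
    have := hV.isHermitian.spectral_theorem
    rw [Unitary.conjStarAlgAut_apply] at this
    simpa [star_eq_conjTranspose] using this
  have hdd : diagonal hV.isHermitian.eigenvalues *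
      diagonal (fun j => (hV.isHermitian.eigenvalues j)⁻¹) = 1 := by
    rw [diagonal_mul_diagonal, ← diagonal_one]
    congr 1; ext j
    exact mul_inv_cancel₀ (hV.eigenvalues_pos j).ne'
  have hinv : V⁻¹ = U * diagonal (fun j => (hV.isHermitian.eigenvalues j)⁻¹) * Uᴴ := by
    apply inv_eq_right_inv
    set D := diagonal hV.isHermitian.eigenvalues
    set D' := diagonal (fun j => (hV.isHermitian.eigenvalues j)⁻¹)
    calc V * (U * D' * Uᴴ) = U * D * (Uᴴ * U) * D' * Uᴴ := by
          conv_lhs => rw [hs]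
          simp only [mul_assoc]
      _ = 1 := by rw [hUU', mul_one, mul_assoc U, hdd, mul_one, hUU]
  refine ⟨U, ?_⟩
  have : diagonal (fun j => a + b * (hV.isHermitian.eigenvalues j)⁻¹) =
      a • (1 : Matrix (Fin d) (Fin d) ℝ) +
        b • diagonal (fun j => (hV.isHermitian.eigenvalues j)⁻¹) := by
    ext i j
    by_cases h : i = j
    · subst h; simp
    · simp [h]
  rw [this, mul_add, add_mul, mul_smul_comm, smul_mul_assoc, mul_one, hUU, mul_smul_comm,
    smul_mul_assoc, ← hinv]

/-- A scalar inequality on the spectrum, transferred by diagonalization. It serves to compare `1`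
with `λ_min V⁻¹` and `λ_max V⁻¹` in the Loewner order. -/
lemma posSemidef_smul_one_add_smul_inv (hV : V.PosDef) (a b : ℝ)
    (h : ∀ l, 0 < l → Module.End.HasEigenvalue (toLin' V) l → 0 ≤ a + b * l⁻¹) :
    (a • (1 : Matrix (Fin d) (Fin d) ℝ) + b • V⁻¹).PosSemidef := by
  obtain ⟨U, hU⟩ := exists_unitary_diagonal hV a b
  rw [hU]
  refine PosSemidef.mul_mul_conjTranspose_same (PosSemidef.diagonal fun j => ?_) U
  exact h _ (hV.eigenvalues_pos j) (hasEigenvalue_eigenvalues _ j)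

lemma mul_trace_inv_mul_le_trace (hV : V.PosDef) {lamMin : ℝ}
    (hlam : lamMin ∈ lowerBounds {l : ℝ | Module.End.HasEigenvalue (toLin' V) l})
    {M : Matrix (Fin d) (Fin d) ℝ} (hM : M.PosSemidef) :
    lamMin * (V⁻¹ * M).trace ≤ M.trace := by
  have h := trace_mul_nonneg_of_posSemidef (posSemidef_smul_one_add_smul_inv hV 1 (-lamMin)
    fun l hl hl' => by
      have := hlam hl'
      have : lamMin * l⁻¹ ≤ 1 := by rw [← div_eq_mul_inv]; exact div_le_one_of_le₀ this hl.le
      linarith) hM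
  simp only [one_smul, add_mul, one_mul, trace_add, smul_mul_assoc, trace_smul,
    smul_eq_mul] at h
  linarith

lemma trace_le_mul_trace_inv_mul (hV : V.PosDef) {lamMax : ℝ}
    (hlam : lamMax ∈ upperBounds {l : ℝ | Module.End.HasEigenvalue (toLin' V) l})
    {M : Matrix (Fin d) (Fin d) ℝ} (hM : M.PosSemidef) :
    M.trace ≤ lamMax * (V⁻¹ * M).trace := by
  have h := trace_mul_nonneg_of_posSemidef (posSemidef_smul_one_add_smul_inv hV (-1) lamMax
    fun l hl hl' => by
      have := hlam hl'
      have : 1 ≤ lamMax * l⁻¹ := by rw [← div_eq_mul_inv]; exact (one_le_div hl).2 this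
      linarith) hM
  simp only [neg_smul, one_smul, add_mul, neg_mul, one_mul, trace_add, trace_neg, smul_mul_assoc,
    trace_smul, smul_eq_mul] at h
  linarith

lemma eigenvalue_pos (hV : V.PosDef) {l : ℝ} (hl : Module.End.HasEigenvalue (toLin' V) l) :
    0 < l := by
  rw [Module.End.hasEigenvalue_iff_mem_spectrum, spectrum_toLin',
    hV.isHermitian.spectrum_real_eq_range_eigenvalues] at hl
  obtain ⟨j, rfl⟩ := hl
  exact hV.eigenvalues_pos j

lemma trace_inv_mul_self (hV : V.PosDef) : (V⁻¹ * V).trace = d := by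
  rw [nonsing_inv_mul _ ((isUnit_iff_isUnit_det _).1 hV.isUnit), trace_one, Fintype.card_fin]

lemma le_one_of_mem_lowerBounds [NeZero d] (hV : V.PosDef) (hdiag : ∀ j, V j j = 1) {lamMin : ℝ}
    (hlam : lamMin ∈ lowerBounds {l : ℝ | Module.End.HasEigenvalue (toLin' V) l}) :
    lamMin ≤ 1 := by
  have h := mul_trace_inv_mul_le_trace hV hlam hV.posSemidef
  have hd : (0 : ℝ) < d := by exact_mod_cast NeZero.pos d
  have ht : V.trace = d := by simp [trace, hdiag]
  rw [trace_inv_mul_self hV, ht] at h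
  exact le_of_mul_le_mul_right (by linarith) hd

/-- The contracted quantity is `tr (V⁻¹ Tⁿ V)`, not the trace itself; passing back to the trace
costs the factor `lamMax`. -/
lemma trace_averagedStep_iterate_le_geometric [NeZero d] (hV : V.PosDef)
    (hdiag : ∀ j, V j j = 1) {lamMin lamMax : ℝ}
    (hmin : IsLeast {l : ℝ | Module.End.HasEigenvalue (toLin' V) l} lamMin)
    (hmax : IsGreatest {l : ℝ | Module.End.HasEigenvalue (toLin' V) l} lamMax) (n : ℕ) :
    ((averagedStep V)^[n] V).trace ≤ lamMax * d * (1 - lamMin / d) ^ n := by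
  have hd : (1 : ℝ) ≤ d := by exact_mod_cast NeZero.one_le
  have hl := eigenvalue_pos hV hmax.1
  have h1 : 0 ≤ 1 - lamMin / d := by
    have := le_one_of_mem_lowerBounds hV hdiag hmin.2
    rw [sub_nonneg]
    exact div_le_one_of_le₀ (by linarith) (by linarith)
  refine (trace_le_mul_trace_inv_mul hV hmax.2
    (averagedStep_iterate_posSemidef hV.posSemidef n)).trans ?_
  rw [mul_assoc]
  gcongr
  induction n with
  | zero => simp [trace_inv_mul_self hV]
  | succ n ih =>
    rw [Function.iterate_succ_apply', trace_inv_mul_averagedStep hV hdiag]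
    have h := mul_trace_inv_mul_le_trace hV hmin.2
      (averagedStep_iterate_posSemidef hV.posSemidef n)
    calc _ ≤ (V⁻¹ * (averagedStep V)^[n] V).trace -
          lamMin * (V⁻¹ * (averagedStep V)^[n] V).trace / d := by gcongr
      _ = (1 - lamMin / d) * (V⁻¹ * (averagedStep V)^[n] V).trace := by ring
      _ ≤ (1 - lamMin / d) * (d * (1 - lamMin / d) ^ n) := by gcongr
      _ = _ := by ring

lemma trace_averagedStep_iterate_antitone [NeZero d] (hV : V.transpose = V)
    (hdiag : ∀ j, V j j = 1) : Antitone fun n => ((averagedStep V)^[n] V).trace := by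
  refine antitone_nat_of_succ_le fun n => ?_
  have := (averagedStep_iterate_sub_posSemidef hV hdiag n).trace_nonneg
  rw [trace_sub] at this
  linarith

lemma trace_averagedStep_iterate_le_harmonic [NeZero d] (hV : V.PosDef)
    (hdiag : ∀ j, V j j = 1) (n : ℕ) :
    ((averagedStep V)^[n] V).trace ≤ (d : ℝ) ^ 2 / ((n : ℝ) + 1) := by
  have hd : (0 : ℝ) < d := by exact_mod_cast NeZero.pos d
  have hVt : V.transpose = V := by simpa using hV.isHermitian.eq
  -- Telescoping of `trace_inv_mul_averagedStep`, from the initial value `tr (V⁻¹ V) = d`.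
  have hsum (n : ℕ) : ∑ k ∈ range n, ((averagedStep V)^[k] V).trace =
      d * (d - (V⁻¹ * (averagedStep V)^[n] V).trace) := by
    induction n with
    | zero => simp [trace_inv_mul_self hV]
    | succ n ih =>
      rw [sum_range_succ, ih, Function.iterate_succ_apply', trace_inv_mul_averagedStep hV hdiag]
      field_simp
      ring
  have h0 := trace_mul_nonneg_of_posSemidef hV.inv.posSemidef
    (averagedStep_iterate_posSemidef hV.posSemidef (n + 1))
  -- The last of the `n + 1` traces is the smallest.
  have hle : ((n + 1 : ℕ) : ℝ) * ((averagedStep V)^[n] V).trace ≤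
      ∑ k ∈ range (n + 1), ((averagedStep V)^[k] V).trace := by
    have := card_nsmul_le_sum (range (n + 1)) (fun k => ((averagedStep V)^[k] V).trace)
      ((averagedStep V)^[n] V).trace fun k hk =>
        trace_averagedStep_iterate_antitone hVt hdiag (Nat.lt_succ_iff.1 (mem_range.1 hk))
    simpa using this
  rw [hsum] at hle
  rw [le_div_iff₀ (by positivity)]
  push_cast at hle
  nlinarith [mul_nonneg hd.le h0]

end LinearAlgebra

/-! ### Gaussian combinations with fixed coefficients. -/

section GaussianSums

open Matrix Finset

variable {Ω : Type*} [MeasurableSpace Ω] {P : Measure Ω} {d : ℕ}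

lemma hasGaussianLaw_sum_smul_prodMk {E : Type*} [NormedAddCommGroup E] [NormedSpace ℝ E]
    [MeasurableSpace E] [BorelSpace E] [SecondCountableTopology E]
    {g : ℕ → Ω → ℝ} (hg : ∀ k, HasGaussianLaw (g k) P)
    (hind : iIndepFun g P) (n : ℕ) (a b : ℕ → E) :
    HasGaussianLaw (fun ω => (∑ k ∈ range n, g k ω • a k, ∑ k ∈ range n, g k ω • b k)) P := by
  have h := iIndepFun.hasGaussianLaw (X := fun k : Fin n => g k) (fun k => hg k)
    (hind.precomp Fin.val_injective)
  have := h.map_fun (∑ k : Fin n,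
    (ContinuousLinearMap.proj (R := ℝ) (φ := fun _ : Fin n => ℝ) k).smulRight (a k, b k))
  refine this.congr (ae_of_all _ fun ω => ?_)
  simp only [_root_.sum_apply]
  rw [Prod.ext_iff, Prod.fst_sum, Prod.snd_sum, Finset.sum_range, Finset.sum_range]
  simp

lemma integral_mul_of_iIndepFun {g : ℕ → Ω → ℝ} (hlaw : ∀ k, HasLaw (g k) (gaussianReal 0 1) P)
    (hind : iIndepFun g P) (k l : ℕ) :
    ∫ ω, g k ω * g l ω ∂P = if k = l then 1 else 0 := by
  have h0 (k : ℕ) : ∫ ω, g k ω ∂P = 0 := by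
    rw [(hlaw k).integral_eq, integral_id_gaussianReal]
  have hm (k : ℕ) : AEStronglyMeasurable (g k) P := (hlaw k).aemeasurable.aestronglyMeasurable
  split_ifs with h
  · subst h
    have := (hlaw k).variance_eq
    rw [variance_id_gaussianReal, variance_eq_integral (hlaw k).aemeasurable, h0] at this
    simpa [sq] using this
  · rw [(hind.indepFun h).integral_fun_mul_eq_mul_integral (hm k) (hm l), h0, zero_mul]

lemma integral_sum_mul_sum {g : ℕ → Ω → ℝ} (hlaw : ∀ k, HasLaw (g k) (gaussianReal 0 1) P)
    (hind : iIndepFun g P) (n : ℕ) (a b : ℕ → ℝ) :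
    ∫ ω, (∑ k ∈ range n, g k ω * a k) * (∑ k ∈ range n, g k ω * b k) ∂P =
      ∑ k ∈ range n, a k * b k := by
  have hL (k : ℕ) : MemLp (g k) 2 P := (hlaw k).hasGaussianLaw.memLp_two
  simp_rw [sum_mul_sum, mul_mul_mul_comm]
  have hi (k l : ℕ) : Integrable (fun ω => g k ω * g l ω * (a k * b l)) P :=
    ((hL k).integrable_mul (hL l)).mul_const _
  rw [integral_finsetSum _ fun k _ => integrable_finsetSum _ fun l _ => hi k l]
  refine sum_congr rfl fun k hk => ?_
  rw [integral_finsetSum _ fun l _ => hi k l]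
  simp_rw [integral_mul_const, integral_mul_of_iIndepFun hlaw hind, ite_mul, one_mul, zero_mul]
  rw [sum_ite_eq, if_pos hk]

/-- The covariance matrix of `∑ k < n, g k • a k` for i.i.d. standard Gaussian `g k`. -/
def gramSum (n : ℕ) (a : ℕ → Fin d → ℝ) : Matrix (Fin d) (Fin d) ℝ :=
  ∑ k ∈ range n, vecMulVec (a k) (a k)

lemma covMatrix_map_sum_smul {g : ℕ → Ω → ℝ} (hlaw : ∀ k, HasLaw (g k) (gaussianReal 0 1) P)
    (hind : iIndepFun g P) (n : ℕ) (a : ℕ → Fin d → ℝ) :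
    covMatrix (P.map fun ω => ∑ k ∈ range n, g k ω • WithLp.toLp 2 (a k)) = gramSum n a := by
  have hint (k : ℕ) : Integrable (g k) P := (hlaw k).hasGaussianLaw.integrable
  have hmean (j : Fin d) : ∫ ω, ∑ k ∈ range n, g k ω * a k j ∂P = 0 := by
    rw [integral_finsetSum _ fun k _ => (hint k).mul_const _]
    simp_rw [integral_mul_const, (hlaw _).integral_eq, integral_id_gaussianReal, zero_mul,
      sum_const_zero]
  have hm (k : ℕ) : AEMeasurable (g k) P := (hlaw k).aemeasurable
  ext i j
  rw [covMatrix, of_apply, covariance_map_fun (by fun_prop) (by fun_prop) (by fun_prop)]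
  simp only [WithLp.ofLp_sum, WithLp.ofLp_smul, Finset.sum_apply, Pi.smul_apply, smul_eq_mul,
    covariance, hmean, sub_zero]
  rw [integral_sum_mul_sum hlaw hind, gramSum, Matrix.sum_apply]
  simp [vecMulVec_apply]

lemma integral_norm_sq_sum_smul {g : ℕ → Ω → ℝ} (hlaw : ∀ k, HasLaw (g k) (gaussianReal 0 1) P)
    (hind : iIndepFun g P) (n : ℕ) (a : ℕ → Fin d → ℝ) :
    ∫ ω, ‖∑ k ∈ range n, g k ω • WithLp.toLp 2 (a k)‖ ^ 2 ∂P = (gramSum n a).trace := by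
  have hL (k : ℕ) : MemLp (g k) 2 P := (hlaw k).hasGaussianLaw.memLp_two
  simp only [EuclideanSpace.real_norm_sq_eq, WithLp.ofLp_sum, WithLp.ofLp_smul, Finset.sum_apply,
    Pi.smul_apply, smul_eq_mul]
  rw [integral_finsetSum]
  · simp_rw [sq, integral_sum_mul_sum hlaw hind, gramSum, trace, Matrix.diag, Matrix.sum_apply,
      vecMulVec_apply]
  · intro i _
    refine MemLp.integrable_sq ?_
    exact memLp_finsetSum _ fun k _ => (hL k).mul_const _

/-- The Hölder hypothesis with the directions frozen: both vectors are linear in the same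
innovations, hence jointly Gaussian, possibly degenerate. -/
lemma lintegral_sq_sub_le_of_gaussianHolder {V : Matrix (Fin d) (Fin d) ℝ} {κ γ : ℝ}
    {f : EuclideanSpace ℝ (Fin d) → ℝ} (hf : Measurable f) (hfH : GaussianHolder V κ γ f)
    {g : ℕ → Ω → ℝ} (hlaw : ∀ k, HasLaw (g k) (gaussianReal 0 1) P)
    (hind : iIndepFun g P) (n : ℕ) (a b : ℕ → Fin d → ℝ)
    (ha : (V - gramSum n a).PosSemidef) (hb : (V - gramSum n b).PosSemidef) :
    ∫⁻ ω, ENNReal.ofReal ((f (∑ k ∈ range n, g k ω • WithLp.toLp 2 (a k)) -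
        f (∑ k ∈ range n, g k ω • WithLp.toLp 2 (b k))) ^ 2) ∂P ≤
      ENNReal.ofReal (κ ^ 2 * (gramSum n (fun k => a k - b k)).trace ^ γ) := by
  have hG := hasGaussianLaw_sum_smul_prodMk (fun k => (hlaw k).hasGaussianLaw) hind n
    (fun k => WithLp.toLp 2 (a k)) (fun k => WithLp.toLp 2 (b k))
  have hm (k : ℕ) : AEMeasurable (g k) P := (hlaw k).aemeasurable
  have hint (k : ℕ) : Integrable (g k) P := (hlaw k).hasGaussianLaw.integrable
  have hzero (c : ℕ → Fin d → ℝ) :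
      ∫ ω, ∑ k ∈ range n, g k ω • WithLp.toLp 2 (c k) ∂P = 0 := by
    rw [integral_finsetSum _ fun k _ => (hint k).smul_const _]
    simp_rw [integral_smul_const, (hlaw _).integral_eq, integral_id_gaussianReal, zero_smul,
      sum_const_zero]
  set Z := fun ω => (∑ k ∈ range n, g k ω • WithLp.toLp 2 (a k),
    ∑ k ∈ range n, g k ω • WithLp.toLp 2 (b k)) with hZ
  have hZm : AEMeasurable Z P := hG.aemeasurable
  have hpair : IsGaussianPairBelow V (P.map Z) := by
    refine ⟨hG.isGaussian_map, ?_, ?_, ?_⟩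
    · rw [integral_map hZm (by fun_prop)]
      have h1 (c : ℕ → Fin d → ℝ) :
          Integrable (fun ω => ∑ k ∈ range n, g k ω • WithLp.toLp 2 (c k)) P :=
        integrable_finsetSum _ fun k _ => (hint k).smul_const _
      rw [hZ, integral_pair (h1 a) (h1 b), hzero, hzero]
      rfl
    · rw [AEMeasurable.map_map_of_aemeasurable (by fun_prop) hZm]
      change (V - covMatrix (P.map fun ω => ∑ k ∈ range n, g k ω • WithLp.toLp 2 (a k))).PosSemidef
      rwa [covMatrix_map_sum_smul hlaw hind]
    · rw [AEMeasurable.map_map_of_aemeasurable (by fun_prop) hZm]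
      change (V - covMatrix (P.map fun ω => ∑ k ∈ range n, g k ω • WithLp.toLp 2 (b k))).PosSemidef
      rwa [covMatrix_map_sum_smul hlaw hind]
  have h := hfH _ hpair
  rw [lintegral_map' (by fun_prop) hZm, integral_map hZm (by fun_prop)] at h
  refine h.trans (le_of_eq ?_)
  congr 3
  rw [← integral_norm_sq_sum_smul hlaw hind]
  simp only [hZ, ← sum_sub_distrib, ← smul_sub, ← WithLp.toLp_sub]

end GaussianSums

/-! ### The chain as a linear function of its innovations. -/

section Chain

open Matrix Finset

variable {d : ℕ}

/-- The product `P_{n-1} ⋯ P_0` of the step matrices along `w`. -/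
def propagator (V : Matrix (Fin d) (Fin d) ℝ) (w : ℕ → Fin d → ℝ) :
    ℕ → Matrix (Fin d) (Fin d) ℝ
  | 0 => 1
  | n + 1 => stepMatrix V (w n) * propagator V w n

/-- The coefficient of the `k`-th innovation in the state of the chain after `n` steps. -/
def chainCoeff (V : Matrix (Fin d) (Fin d) ℝ) (w : ℕ → Fin d → ℝ) : ℕ → ℕ → Fin d → ℝ
  | 0, _ => 0
  | n + 1, k => if k = n then V *ᵥ w n else stepMatrix V (w n) *ᵥ chainCoeff V w n k

variable (V : Matrix (Fin d) (Fin d) ℝ)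

lemma gaussianUpdate_eq (x : EuclideanSpace ℝ (Fin d)) (u : ℝ) (y : EuclideanSpace ℝ (Fin d)) :
    gaussianUpdate V x (u, y) =
      WithLp.toLp 2 (stepMatrix V y.ofLp *ᵥ x.ofLp) + u • WithLp.toLp 2 (V *ᵥ y.ofLp) := by
  have h : inner ℝ y x = y.ofLp ⬝ᵥ x.ofLp := by
    rw [EuclideanSpace.inner_eq_star_dotProduct, dotProduct_comm]; rfl
  have h2 : stepMatrix V y.ofLp *ᵥ x.ofLp = x.ofLp - (y.ofLp ⬝ᵥ x.ofLp) • (V *ᵥ y.ofLp) := by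
    rw [stepMatrix, sub_mulVec, one_mulVec, ← mulVec_mulVec, vecMulVec_mulVec,
      mulVec_smul, op_smul_eq_smul]
  rw [h2, gaussianUpdate, h, WithLp.toLp_sub, WithLp.toLp_smul, WithLp.toLp_ofLp, sub_smul]
  abel

lemma iterMap_gaussianUpdate (n : ℕ) (u : ℕ → ℝ) (w : ℕ → EuclideanSpace ℝ (Fin d)) :
    iterMap (gaussianUpdate V) n 0 (fun k => (u k, w k)) =
      ∑ k ∈ range n, u k • WithLp.toLp 2 (chainCoeff V (fun k => (w k).ofLp) n k) := by
  induction n with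
  | zero => simp [iterMap]
  | succ n ih =>
    rw [iterMap, gaussianUpdate_eq, ih, sum_range_succ]
    congr 1
    · simp only [WithLp.ofLp_sum, WithLp.ofLp_smul, mulVec_sum, mulVec_smul, WithLp.toLp_sum,
        WithLp.toLp_smul]
      refine sum_congr rfl fun k hk => ?_
      rw [chainCoeff, if_neg (mem_range.1 hk).ne]
    · rw [chainCoeff, if_pos rfl]

lemma chainCoeff_of_le (w : ℕ → Fin d → ℝ) {n k : ℕ} (h : n ≤ k) : chainCoeff V w n k = 0 := by
  induction n with
  | zero => rfl
  | succ n ih => rw [chainCoeff, if_neg (by omega), ih (by omega), mulVec_zero]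

/-- An innovation older than time `m` is only transported by the later step matrices. -/
lemma chainCoeff_add_of_lt (w : ℕ → Fin d → ℝ) (n : ℕ) {m k : ℕ} (h : k < m) :
    chainCoeff V w (n + m) k =
      propagator V (fun l => w (l + m)) n *ᵥ chainCoeff V w m k := by
  induction n with
  | zero => simp [propagator]
  | succ n ih =>
    rw [show n + 1 + m = n + m + 1 by omega, chainCoeff, if_neg (by omega), ih, propagator,
      mulVec_mulVec]

/-- Innovations from time `m` on do not see the past, so they have equal coefficients in the early
and late chains and cancel in the difference. -/
lemma chainCoeff_add_add (w : ℕ → Fin d → ℝ) (n m k : ℕ) :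
    chainCoeff V w (n + m) (k + m) = chainCoeff V (fun l => w (l + m)) n k := by
  induction n with
  | zero => rw [chainCoeff_of_le V w (by omega)]; rfl
  | succ n ih =>
    rw [show n + 1 + m = n + m + 1 by omega, chainCoeff, chainCoeff, ih]
    simp

lemma mul_gramSum_mul_transpose (B : Matrix (Fin d) (Fin d) ℝ) (n : ℕ) (a : ℕ → Fin d → ℝ) :
    B * gramSum n a * B.transpose = gramSum n (fun k => B *ᵥ a k) := by
  simp only [gramSum, mul_sum, sum_mul, mul_vecMulVec, vecMulVec_mul, vecMul_transpose]

lemma gramSum_congr {n : ℕ} {a b : ℕ → Fin d → ℝ} (h : ∀ k < n, a k = b k) :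
    gramSum n a = gramSum n b :=
  sum_congr rfl fun k hk => by rw [h k (mem_range.1 hk)]

variable {V}

/-- By invariance of `V`, the gap to `V` is conjugated by the step matrix at each step, starting
from `V` itself. -/
lemma sub_gramSum_chainCoeff_posSemidef (hV : V.PosSemidef) (hdiag : ∀ j, V j j = 1)
    {w : ℕ → Fin d → ℝ} (hw : ∀ n, ∃ j, w n = Pi.single j 1) (n : ℕ) :
    (V - gramSum n (chainCoeff V w n)).PosSemidef := by
  have hVt : V.transpose = V := by simpa using hV.isHermitian.eq
  induction n with
  | zero => simpa [gramSum]
  | succ n ih =>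
    obtain ⟨j, hj⟩ := hw n
    have h := posSemidef_mul_mul_transpose ih (stepMatrix V (w n))
    have h2 : gramSum (n + 1) (chainCoeff V w (n + 1)) =
        stepMatrix V (w n) * gramSum n (chainCoeff V w n) * (stepMatrix V (w n)).transpose +
          vecMulVec (V *ᵥ w n) (V *ᵥ w n) := by
      rw [mul_gramSum_mul_transpose, gramSum, sum_range_succ]
      congr 1
      · exact gramSum_congr fun k hk => by rw [chainCoeff, if_neg hk.ne]
      · rw [chainCoeff, if_pos rfl]
    rw [h2]
    rw [mul_sub, sub_mul, hj, stepMatrix_mul_mul_transpose hVt hdiag, ← hj] at h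
    convert h using 1
    abel

/-- The coefficients, in the innovations of the chain started `m` steps earlier, of the chain
started at time `0`. -/
def lateChainCoeff (V : Matrix (Fin d) (Fin d) ℝ) (w : ℕ → Fin d → ℝ) (n m k : ℕ) : Fin d → ℝ :=
  if k < m then 0 else chainCoeff V (fun l => w (l + m)) n (k - m)

lemma gramSum_lateChainCoeff (w : ℕ → Fin d → ℝ) (n m : ℕ) :
    gramSum (n + m) (lateChainCoeff V w n m) =
      gramSum n (chainCoeff V (fun l => w (l + m)) n) := by
  rw [gramSum, add_comm, sum_range_add, sum_eq_zero, zero_add]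
  · refine sum_congr rfl fun k _ => ?_
    simp [lateChainCoeff]
  · intro k hk
    simp [lateChainCoeff, mem_range.1 hk]

lemma iterMap_gaussianUpdate_late (n m : ℕ) (u : ℕ → ℝ) (w : ℕ → EuclideanSpace ℝ (Fin d)) :
    iterMap (gaussianUpdate V) n 0 (fun k => (u (k + m), w (k + m))) =
      ∑ k ∈ range (n + m),
        u k • WithLp.toLp 2 (lateChainCoeff V (fun k => (w k).ofLp) n m k) := by
  have h0 : ∑ k ∈ range m,
      u k • WithLp.toLp 2 (lateChainCoeff V (fun k => (w k).ofLp) n m k) = 0 :=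
    sum_eq_zero fun k hk => by simp [lateChainCoeff, mem_range.1 hk]
  rw [iterMap_gaussianUpdate V n (fun k => u (k + m)) (fun k => w (k + m)), add_comm n m,
    sum_range_add, h0, zero_add]
  refine sum_congr rfl fun k _ => ?_
  rw [lateChainCoeff, if_neg (by omega), Nat.add_sub_cancel_left, add_comm m]

/-- Only the first `m` innovations survive; they give `Q C Qᵀ` with `C ≤ V` the covariance at time
`m`. -/
lemma trace_gramSum_sub_lateChainCoeff_le (hV : V.PosSemidef) (hdiag : ∀ j, V j j = 1)
    {w : ℕ → Fin d → ℝ} (hw : ∀ n, ∃ j, w n = Pi.single j 1) (n m : ℕ) :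
    (gramSum (n + m) (fun k => chainCoeff V w (n + m) k - lateChainCoeff V w n m k)).trace ≤
      (propagator V (fun l => w (l + m)) n * V *
        (propagator V (fun l => w (l + m)) n).transpose).trace := by
  have h : gramSum (n + m) (fun k => chainCoeff V w (n + m) k - lateChainCoeff V w n m k) =
      propagator V (fun l => w (l + m)) n * gramSum m (chainCoeff V w m) *
        (propagator V (fun l => w (l + m)) n).transpose := by
    rw [mul_gramSum_mul_transpose, gramSum, add_comm n m, sum_range_add, add_comm m n,
      add_eq_left.2]
    · refine gramSum_congr fun k hk => ?_
      rw [chainCoeff_add_of_lt V w n hk, lateChainCoeff, if_pos hk, sub_zero]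
    · refine sum_eq_zero fun k _ => ?_
      rw [lateChainCoeff, if_neg (by omega), Nat.add_sub_cancel_left, add_comm m k,
        chainCoeff_add_add, sub_self, vecMulVec_zero]
  have h2 := (posSemidef_mul_mul_transpose
    (sub_gramSum_chainCoeff_posSemidef hV hdiag hw m)
      (propagator V (fun l => w (l + m)) n)).trace_nonneg
  rw [mul_sub, sub_mul, trace_sub] at h2
  rw [h]
  linarith

end Chain

/-! ### Continuity of the chain in its inputs. -/

section Measurability

open Matrix Finset

variable {d : ℕ} (V : Matrix (Fin d) (Fin d) ℝ)

lemma continuous_stepMatrix : Continuous (stepMatrix V) := by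
  unfold stepMatrix
  fun_prop

lemma continuous_propagator (n : ℕ) :
    Continuous fun w : ℕ → EuclideanSpace ℝ (Fin d) => propagator V (fun k => (w k).ofLp) n := by
  induction n with
  | zero => exact continuous_const
  | succ n ih =>
    exact ((continuous_stepMatrix V).comp (by fun_prop)).matrix_mul ih

lemma continuous_gaussianUpdate :
    Continuous fun p : EuclideanSpace ℝ (Fin d) × (ℝ × EuclideanSpace ℝ (Fin d)) =>
      gaussianUpdate V p.1 p.2 := by
  unfold gaussianUpdate
  fun_prop

lemma continuous_iterMap_gaussianUpdate (n : ℕ) :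
    Continuous fun p : (ℕ → ℝ) × (ℕ → EuclideanSpace ℝ (Fin d)) =>
      iterMap (gaussianUpdate V) n 0 (fun k => (p.1 k, p.2 k)) := by
  induction n with
  | zero => exact continuous_const
  | succ n ih =>
    exact (continuous_gaussianUpdate V).comp (ih.prodMk (by fun_prop))

lemma propagator_congr {w w' : ℕ → Fin d → ℝ} {n : ℕ} (h : ∀ k < n, w k = w' k) :
    propagator V w n = propagator V w' n := by
  induction n with
  | zero => rfl
  | succ n ih =>
    rw [propagator, propagator, h n (by omega), ih fun k hk => h k (by omega)]

end Measurability

/-! ### Integration against the uniform law on the basis. -/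

section UniformBasis

open Matrix Finset

variable {d : ℕ}

lemma ae_uniformBasisLaw :
    ∀ᵐ y ∂(uniformBasisLaw d), ∃ j, y = EuclideanSpace.single j 1 := by
  refine Measure.ae_smul_measure ?_ _
  rw [ae_finsetSum_measure_iff]
  intro j _
  rw [ae_dirac_eq]
  exact ⟨j, rfl⟩

lemma integrable_uniformBasisLaw [NeZero d] {h : EuclideanSpace ℝ (Fin d) → ℝ} :
    Integrable h (uniformBasisLaw d) := by
  refine Integrable.smul_measure ?_ (by simp [NeZero.ne d])
  rw [integrable_finsetSum_measure]
  exact fun j _ => integrable_dirac (by simp)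

lemma integral_uniformBasisLaw (h : EuclideanSpace ℝ (Fin d) → ℝ) :
    ∫ y, h y ∂(uniformBasisLaw d) = (d : ℝ)⁻¹ * ∑ j, h (EuclideanSpace.single j 1) := by
  rw [uniformBasisLaw, integral_smul_measure,
    integral_finsetSum_measure fun j _ => integrable_dirac (by simp)]
  simp

end UniformBasis

/-! ### Averaging over the random directions. -/

section Expectation

open Matrix Finset

variable {Ω : Type*} {d : ℕ} (V : Matrix (Fin d) (Fin d) ℝ)

/-- The covariance matrix `V` transported along the step matrices of `e`. -/
def transported (e : ℕ → Ω → EuclideanSpace ℝ (Fin d)) (n : ℕ) (ω : Ω) :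
    Matrix (Fin d) (Fin d) ℝ :=
  propagator V (fun k => (e k ω).ofLp) n * V * (propagator V (fun k => (e k ω).ofLp) n).transpose

lemma transported_succ_apply (e : ℕ → Ω → EuclideanSpace ℝ (Fin d)) (n : ℕ) (ω : Ω)
    (a b : Fin d) :
    transported V e (n + 1) ω a b = ∑ r, ∑ s, transported V e n ω s r *
      (stepMatrix V (e n ω).ofLp a s * stepMatrix V (e n ω).ofLp b r) := by
  have : transported V e (n + 1) ω = stepMatrix V (e n ω).ofLp * transported V e n ω *
      (stepMatrix V (e n ω).ofLp).transpose := by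
    simp only [transported, propagator, transpose_mul, mul_assoc]
  rw [this, mul_apply]
  simp only [mul_apply, sum_mul, transpose_apply]
  exact sum_congr rfl fun r _ => sum_congr rfl fun s _ => by ring

lemma averagedStep_apply (M : Matrix (Fin d) (Fin d) ℝ) (a b : Fin d) :
    averagedStep V M a b = ∑ r, ∑ s, M s r * ((d : ℝ)⁻¹ * ∑ j,
      stepMatrix V (Pi.single j 1) a s * stepMatrix V (Pi.single j 1) b r) := by
  rw [averagedStep, Matrix.smul_apply, Matrix.sum_apply, smul_eq_mul]
  simp only [mul_apply, sum_mul, transpose_apply, mul_sum]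
  rw [sum_comm]
  refine sum_congr rfl fun r _ => ?_
  rw [sum_comm]
  exact sum_congr rfl fun s _ => sum_congr rfl fun j _ => by ring

variable [MeasurableSpace Ω] {P : Measure Ω}

lemma indepFun_transported {e : ℕ → Ω → EuclideanSpace ℝ (Fin d)} (he : ∀ k, Measurable (e k))
    (hind : iIndepFun e P) (n : ℕ) (s r : Fin d) :
    IndepFun (fun ω => transported V e n ω s r) (e n) P := by
  have h := hind.indepFun_finset (range n) {n} (by simp) he
  -- Padding by `0` exhibits the transported matrix as a function of the first `n` directions alone;
  -- the padded values are never read.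
  let ext : (range n → EuclideanSpace ℝ (Fin d)) → ℕ → EuclideanSpace ℝ (Fin d) :=
    fun z k => if hk : k ∈ range n then z ⟨k, hk⟩ else 0
  have hext : Continuous ext := by
    refine continuous_pi fun k => ?_
    by_cases hk : k ∈ range n
    · simpa only [ext, dif_pos hk] using continuous_apply _
    · simpa only [ext, dif_neg hk] using continuous_const
  let φ : (range n → EuclideanSpace ℝ (Fin d)) → ℝ := fun z =>
    (propagator V (fun k => (ext z k).ofLp) n * V *
      (propagator V (fun k => (ext z k).ofLp) n).transpose) s r
  have hφ : Continuous φ := by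
    have hQ := (continuous_propagator V n).comp hext
    exact ((hQ.matrix_mul continuous_const).matrix_mul hQ.matrix_transpose).matrix_elem s r
  have h2 := h.comp hφ.measurable
    (measurable_pi_apply (⟨n, mem_singleton_self n⟩ : ({n} : Finset ℕ)))
  have hfun : (fun ω => transported V e n ω s r) =
      φ ∘ fun ω (i : range n) => e i ω := by
    ext ω
    have : propagator V (fun k => (e k ω).ofLp) n =
        propagator V (fun k => (ext (fun i => e i ω) k).ofLp) n :=
      propagator_congr V fun k hk => by simp [ext, hk]
    simp only [transported, this, φ, Function.comp]
  rw [hfun]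
  exact h2

variable [IsProbabilityMeasure P]

/-- Entrywise, each step multiplies past entries by a function of the independent direction `e n`,
so expectations factor and one application of `averagedStep` results. -/
lemma integrable_and_integral_transported [NeZero d] {e : ℕ → Ω → EuclideanSpace ℝ (Fin d)}
    (he : ∀ k, Measurable (e k)) (hlaw : ∀ k, P.map (e k) = uniformBasisLaw d)
    (hind : iIndepFun e P) (n : ℕ) (a b : Fin d) :
    Integrable (fun ω => transported V e n ω a b) P ∧
      ∫ ω, transported V e n ω a b ∂P = ((averagedStep V)^[n] V) a b := by
  induction n generalizing a b with
  | zero => simp [transported, propagator]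
  | succ n ih =>
    have hc (a b s r : Fin d) : Continuous fun y : EuclideanSpace ℝ (Fin d) =>
        stepMatrix V y.ofLp a s * stepMatrix V y.ofLp b r := by
      have h1 : Continuous fun y : EuclideanSpace ℝ (Fin d) => stepMatrix V y.ofLp :=
        (continuous_stepMatrix V).comp (by fun_prop)
      exact (h1.matrix_elem a s).mul (h1.matrix_elem b r)
    have hint (s r : Fin d) : Integrable (fun ω =>
        stepMatrix V (e n ω).ofLp a s * stepMatrix V (e n ω).ofLp b r) P := by
      have : Integrable (fun y : EuclideanSpace ℝ (Fin d) =>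
          stepMatrix V y.ofLp a s * stepMatrix V y.ofLp b r) (P.map (e n)) := by
        rw [hlaw]; exact integrable_uniformBasisLaw
      exact this.comp_measurable (he n)
    have hval (s r : Fin d) : ∫ ω, stepMatrix V (e n ω).ofLp a s *
        stepMatrix V (e n ω).ofLp b r ∂P = (d : ℝ)⁻¹ * ∑ j,
          stepMatrix V (Pi.single j 1) a s * stepMatrix V (Pi.single j 1) b r := by
      rw [← integral_map (φ := e n) (f := fun y => stepMatrix V y.ofLp a s *
        stepMatrix V y.ofLp b r) (he n).aemeasurable (hc a b s r).aestronglyMeasurable, hlaw,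
        integral_uniformBasisLaw]
      rfl
    have hi (s r : Fin d) : IndepFun (fun ω => transported V e n ω s r)
        (fun ω => stepMatrix V (e n ω).ofLp a s * stepMatrix V (e n ω).ofLp b r) P :=
      (indepFun_transported V he hind n s r).comp measurable_id (hc a b s r).measurable
    have hprod (s r : Fin d) : Integrable (fun ω => transported V e n ω s r *
        (stepMatrix V (e n ω).ofLp a s * stepMatrix V (e n ω).ofLp b r)) P :=
      (hi s r).integrable_mul (ih s r).1 (hint s r)
    simp only [transported_succ_apply]
    refine ⟨integrable_finsetSum _ fun r _ => integrable_finsetSum _ fun s _ => hprod s r, ?_⟩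
    rw [integral_finsetSum _ fun r _ => integrable_finsetSum _ fun s _ => hprod s r,
      Function.iterate_succ_apply', averagedStep_apply]
    refine sum_congr rfl fun r _ => ?_
    rw [integral_finsetSum _ fun s _ => hprod s r]
    refine sum_congr rfl fun s _ => ?_
    rw [(hi s r).integral_fun_mul_eq_mul_integral (ih s r).1.aestronglyMeasurable
      (hint s r).aestronglyMeasurable, (ih s r).2, hval]

lemma integrable_trace_transported [NeZero d] {e : ℕ → Ω → EuclideanSpace ℝ (Fin d)}
    (he : ∀ k, Measurable (e k)) (hlaw : ∀ k, P.map (e k) = uniformBasisLaw d)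
    (hind : iIndepFun e P) (n : ℕ) : Integrable (fun ω => (transported V e n ω).trace) P :=
  integrable_finsetSum _ fun a _ => (integrable_and_integral_transported V he hlaw hind n a a).1

lemma integral_trace_transported [NeZero d] {e : ℕ → Ω → EuclideanSpace ℝ (Fin d)}
    (he : ∀ k, Measurable (e k)) (hlaw : ∀ k, P.map (e k) = uniformBasisLaw d)
    (hind : iIndepFun e P) (n : ℕ) :
    ∫ ω, (transported V e n ω).trace ∂P = ((averagedStep V)^[n] V).trace := by
  have h (a b : Fin d) := integrable_and_integral_transported V he hlaw hind n a b
  exact (integral_finsetSum _ fun a _ => (h a a).1).trans (sum_congr rfl fun a _ => (h a a).2)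

end Expectation

/-! ### Jensen and conditioning. -/

section Bounds

variable {Ω : Type*} [MeasurableSpace Ω] {P : Measure Ω} [IsProbabilityMeasure P]

/-- Jensen for the concave power, read as monotonicity of `L^p` norms on a probability space from
exponent `γ` to `1`. -/
lemma lintegral_ofReal_mul_rpow_le {R : Ω → ℝ} (hR : Integrable R P) (hR0 : ∀ ω, 0 ≤ R ω)
    {c γ : ℝ} (hc : 0 ≤ c) (hγ : 0 < γ) (hγ1 : γ ≤ 1) :
    ∫⁻ ω, ENNReal.ofReal (c * R ω ^ γ) ∂P ≤ ENNReal.ofReal (c * (∫ ω, R ω ∂P) ^ γ) := by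
  have h := eLpNorm'_le_eLpNorm'_of_exponent_le hγ hγ1 P hR.aestronglyMeasurable
  simp only [eLpNorm', ENNReal.rpow_one, div_one] at h
  rw [one_div, ENNReal.rpow_inv_le_iff hγ] at h
  have he (ω : Ω) : ‖R ω‖ₑ = ENNReal.ofReal (R ω) := Real.enorm_of_nonneg (hR0 ω)
  simp only [he] at h
  rw [← ofReal_integral_eq_lintegral_ofReal hR (ae_of_all _ hR0),
    ENNReal.ofReal_rpow_of_nonneg (integral_nonneg hR0) hγ.le] at h
  simp only [ENNReal.ofReal_rpow_of_nonneg (hR0 _) hγ.le] at h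
  simp only [ENNReal.ofReal_mul hc]
  rw [lintegral_const_mul' _ _ ENNReal.ofReal_ne_top]
  gcongr

/-- Fubini for the product law: `W` is frozen while `G` is integrated, which replaces conditioning
on the directions. -/
lemma lintegral_le_of_indepFun {α β : Type*} [MeasurableSpace α] [MeasurableSpace β]
    {G : Ω → α} {W : Ω → β} (hG : Measurable G) (hW : Measurable W) (hind : IndepFun G W P)
    {F : α × β → ENNReal} (hF : Measurable F) {B : Ω → ENNReal}
    (hB : ∀ᵐ ω ∂P, ∫⁻ ω', F (G ω', W ω) ∂P ≤ B ω) :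
    ∫⁻ ω, F (G ω, W ω) ∂P ≤ ∫⁻ ω, B ω ∂P := by
  have := Measure.isProbabilityMeasure_map (μ := P) hG.aemeasurable
  have := Measure.isProbabilityMeasure_map (μ := P) hW.aemeasurable
  have h := (indepFun_iff_map_prod_eq_prod_map_map hG.aemeasurable hW.aemeasurable).1 hind
  rw [← lintegral_map (f := F) (g := fun ω => (G ω, W ω)) hF (hG.prodMk hW), h,
    lintegral_prod_symm _ hF.aemeasurable, lintegral_map (by fun_prop) hW]
  refine lintegral_mono_ae ?_
  filter_upwards [hB] with ω hω
  rwa [lintegral_map (by fun_prop) hG]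

end Bounds

/-! ### Properties of the rate. -/

section Rate

variable {d : ℕ} {lamMin lamMax κ γ : ℝ}

lemma mul_rpow_le_gaussianRate (hq : 0 ≤ 1 - lamMin / d) (hmax : 0 ≤ lamMax) (hγ : 0 ≤ γ)
    {t : ℝ} (ht : 0 ≤ t) {n : ℕ} (h1 : t ≤ lamMax * d * (1 - lamMin / d) ^ n)
    (h2 : t ≤ (d : ℝ) ^ 2 / ((n : ℝ) + 1)) :
    κ ^ 2 * t ^ γ ≤ gaussianRate d lamMin lamMax κ γ n := by
  rw [gaussianRate]
  refine mul_le_mul_of_nonneg_left (le_min ?_ (Real.rpow_le_rpow ht h2 hγ)) (sq_nonneg κ)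
  refine (Real.rpow_le_rpow ht h1 hγ).trans_eq ?_
  rw [Real.mul_rpow (by positivity) (by positivity), mul_comm γ, Real.rpow_natCast_mul hq]

lemma gaussianRate_nonneg (hq : 0 ≤ 1 - lamMin / d) (hmax : 0 ≤ lamMax) (n : ℕ) :
    0 ≤ gaussianRate d lamMin lamMax κ γ n := by
  rw [gaussianRate]
  positivity

lemma gaussianRate_antitone (hq : 0 ≤ 1 - lamMin / d) (hq1 : 1 - lamMin / d ≤ 1)
    (hmax : 0 ≤ lamMax) (hγ : 0 ≤ γ) : Antitone (gaussianRate d lamMin lamMax κ γ) := by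
  refine antitone_nat_of_succ_le fun n => ?_
  simp only [gaussianRate, mul_comm γ, Real.rpow_natCast_mul hq]
  have : (1 - lamMin / d) ^ (n + 1) ≤ (1 - lamMin / d) ^ n :=
    pow_le_pow_of_le_one hq hq1 n.le_succ
  gcongr
  exact n.le_succ

lemma gaussianRate_strictAnti (hd : 0 < d) (hq : 0 < 1 - lamMin / d) (hq1 : 1 - lamMin / d < 1)
    (hmax : 0 < lamMax) (hκ : 0 < κ) (hγ : 0 < γ) :
    StrictAnti (gaussianRate d lamMin lamMax κ γ) := by
  refine strictAnti_nat_of_succ_lt fun n => ?_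
  have hd' : (0 : ℝ) < d := by exact_mod_cast hd
  simp only [gaussianRate, mul_comm γ, Real.rpow_natCast_mul hq.le]
  have h1 : (1 - lamMin / d) ^ (n + 1) < (1 - lamMin / d) ^ n :=
    pow_lt_pow_right_of_lt_one₀ hq hq1 n.lt_succ_self
  refine mul_lt_mul_of_pos_left (lt_min ?_ ?_) (by positivity)
  · refine (min_le_left _ _).trans_lt (mul_lt_mul_of_pos_left ?_ (by positivity))
    exact Real.rpow_lt_rpow (by positivity) h1 hγ
  · refine (min_le_right _ _).trans_lt (Real.rpow_lt_rpow (by positivity) ?_ hγ)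
    gcongr
    exact n.lt_succ_self

lemma gaussianRate_pos (hd : 0 < d) (hq : 0 < 1 - lamMin / d)
    (hmax : 0 < lamMax) (hκ : 0 < κ) (n : ℕ) : 0 < gaussianRate d lamMin lamMax κ γ n := by
  have hd' : (0 : ℝ) < d := by exact_mod_cast hd
  rw [gaussianRate]
  exact mul_pos (by positivity) (lt_min (by positivity) (by positivity))

lemma summable_sqrt_gaussianRate (hq : 0 ≤ 1 - lamMin / d) (hq1 : 1 - lamMin / d < 1)
    (hmax : 0 ≤ lamMax) (hγ : 0 < γ) :
    Summable fun n : ℕ => Real.sqrt (gaussianRate d lamMin lamMax κ γ n / ((n : ℝ) + 1)) := by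
  have hr : Real.sqrt ((1 - lamMin / d) ^ γ) < 1 := by
    rw [Real.sqrt_lt' one_pos, one_pow]
    exact Real.rpow_lt_one hq hq1 hγ
  -- The geometric branch of the minimum suffices, and the factor `1 / (n + 1)` is dropped.
  refine Summable.of_nonneg_of_le (fun n => Real.sqrt_nonneg _) (fun n => ?_)
    ((summable_geometric_of_lt_one (Real.sqrt_nonneg _) hr).mul_left
      (Real.sqrt (κ ^ 2 * (lamMax * d) ^ γ)))
  refine Real.sqrt_le_iff.2 ⟨by positivity, (div_le_self (gaussianRate_nonneg hq hmax n)
    (by linarith [(n.cast_nonneg : (0 : ℝ) ≤ n)])).trans ?_⟩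
  rw [mul_pow, Real.sq_sqrt (by positivity), ← pow_mul, mul_comm n 2, pow_mul,
    Real.sq_sqrt (by positivity)]
  rw [gaussianRate, mul_assoc, ← Real.rpow_mul_natCast hq]
  exact mul_le_mul_of_nonneg_left (min_le_left _ _) (sq_nonneg κ)

end Rate

/-! ### Coupling and integrability of the chain. -/

section CouplingBounds

open Matrix Finset

variable {Ω : Type*} [MeasurableSpace Ω] {P : Measure Ω} {d : ℕ}
  {V : Matrix (Fin d) (Fin d) ℝ} {κ γ : ℝ} {f : EuclideanSpace ℝ (Fin d) → ℝ}
  {g : ℕ → Ω → ℝ} {e : ℕ → Ω → EuclideanSpace ℝ (Fin d)}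

lemma ae_forall_exists_single (he : ∀ k, Measurable (e k))
    (helaw : ∀ k, P.map (e k) = uniformBasisLaw d) :
    ∀ᵐ ω ∂P, ∀ k, ∃ j, (e k ω).ofLp = Pi.single j 1 := by
  rw [ae_all_iff]
  intro k
  have h : ∀ᵐ y ∂(P.map (e k)), ∃ j, y = EuclideanSpace.single j 1 := by
    rw [helaw]
    exact ae_uniformBasisLaw
  filter_upwards [ae_of_ae_map (he k).aemeasurable h] with ω ⟨j, hj⟩
  exact ⟨j, by rw [hj]; rfl⟩

variable [IsProbabilityMeasure P]

/-- Time is shifted so that the early chain starts at index `0` and the late one at index `m`. -/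
lemma lintegral_sq_sub_iterMap_le [NeZero d] (hV : V.PosSemidef) (hdiag : ∀ j, V j j = 1)
    (hf : Measurable f) (hfH : GaussianHolder V κ γ f) (hγ : 0 < γ) (hγ1 : γ ≤ 1)
    (hg : ∀ k, Measurable (g k)) (he : ∀ k, Measurable (e k))
    (hglaw : ∀ k, P.map (g k) = gaussianReal 0 1) (helaw : ∀ k, P.map (e k) = uniformBasisLaw d)
    (hgind : iIndepFun g P) (heind : iIndepFun e P)
    (hge : IndepFun (fun ω k => g k ω) (fun ω k => e k ω) P) (n m : ℕ) :
    ∫⁻ ω, ENNReal.ofReal ((f (iterMap (gaussianUpdate V) (n + m) 0 (fun k => (g k ω, e k ω))) -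
      f (iterMap (gaussianUpdate V) n 0 (fun k => (g (k + m) ω, e (k + m) ω)))) ^ 2) ∂P ≤
      ENNReal.ofReal (κ ^ 2 * ((averagedStep V)^[n] V).trace ^ γ) := by
  have hinj : Function.Injective fun k : ℕ => k + m := add_left_injective m
  have hQ (ω : Ω) : 0 ≤ (transported V (fun k => e (k + m)) n ω).trace :=
    (posSemidef_mul_mul_transpose hV _).trace_nonneg
  have hgl (k : ℕ) : HasLaw (g k) (gaussianReal 0 1) P := ⟨(hg k).aemeasurable, hglaw k⟩
  rw [← integral_trace_transported V (fun k => he (k + m)) (fun k => helaw (k + m))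
    (heind.precomp hinj) n]
  refine (lintegral_le_of_indepFun
    (F := fun p : (ℕ → ℝ) × (ℕ → EuclideanSpace ℝ (Fin d)) =>
      ENNReal.ofReal ((f (iterMap (gaussianUpdate V) (n + m) 0 (fun k => (p.1 k, p.2 k))) -
        f (iterMap (gaussianUpdate V) n 0 (fun k => (p.1 (k + m), p.2 (k + m))))) ^ 2))
    (B := fun ω => ENNReal.ofReal
      (κ ^ 2 * (transported V (fun k => e (k + m)) n ω).trace ^ γ))
    (measurable_pi_lambda _ hg) (measurable_pi_lambda _ he) hge ?_ ?_).trans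
    (lintegral_ofReal_mul_rpow_le (integrable_trace_transported V (fun k => he (k + m))
      (fun k => helaw (k + m)) (heind.precomp hinj) n) hQ (sq_nonneg κ) hγ hγ1)
  · have h1 := (continuous_iterMap_gaussianUpdate V (n + m)).measurable
    have h2 := ((continuous_iterMap_gaussianUpdate V n).comp
      (f := fun p : (ℕ → ℝ) × (ℕ → EuclideanSpace ℝ (Fin d)) =>
        ((fun k => p.1 (k + m)), (fun k => p.2 (k + m)))) (by fun_prop)).measurable
    exact (((hf.comp h1).sub (hf.comp h2)).pow_const 2).ennreal_ofReal
  · filter_upwards [ae_forall_exists_single he helaw] with ω hω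
    have hlate (ω' : Ω) :=
      iterMap_gaussianUpdate_late (V := V) n m (fun k => g k ω') (fun k => e k ω)
    simp only [hlate, iterMap_gaussianUpdate]
    refine (lintegral_sq_sub_le_of_gaussianHolder hf hfH hgl hgind (n + m) _ _
      (sub_gramSum_chainCoeff_posSemidef hV hdiag hω _) ?_).trans ?_
    · rw [gramSum_lateChainCoeff]
      exact sub_gramSum_chainCoeff_posSemidef hV hdiag (fun k => hω (k + m)) _
    · refine ENNReal.ofReal_le_ofReal (mul_le_mul_of_nonneg_left
        (Real.rpow_le_rpow ?_ ?_ hγ.le) (sq_nonneg κ))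
      · exact sum_nonneg' (ι := Fin d) fun a => by
          simp only [gramSum, Matrix.diag, Matrix.sum_apply, vecMulVec_apply]
          exact sum_nonneg fun k _ => mul_self_nonneg _
      · exact trace_gramSum_sub_lateChainCoeff_le hV hdiag hω n m

/-- The Hölder hypothesis is applied to the degenerate pair `(X_n, 0)`, so `f(X_n) - f(0)` is
square-integrable. -/
lemma memLp_two_iterMap (hV : V.PosSemidef) (hdiag : ∀ j, V j j = 1)
    (hf : Measurable f) (hfH : GaussianHolder V κ γ f) (hγ : 0 < γ)
    (hg : ∀ k, Measurable (g k)) (he : ∀ k, Measurable (e k))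
    (hglaw : ∀ k, P.map (g k) = gaussianReal 0 1) (helaw : ∀ k, P.map (e k) = uniformBasisLaw d)
    (hgind : iIndepFun g P)
    (hge : IndepFun (fun ω k => g k ω) (fun ω k => e k ω) P) (n : ℕ) :
    MemLp (fun ω => f (iterMap (gaussianUpdate V) n 0 (fun k => (g k ω, e k ω)))) 2 P := by
  have hgl (k : ℕ) : HasLaw (g k) (gaussianReal 0 1) P := ⟨(hg k).aemeasurable, hglaw k⟩
  have hmeas := (continuous_iterMap_gaussianUpdate V n).measurable
  have hG : Measurable fun ω k => g k ω := measurable_pi_lambda _ hg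
  have hW : Measurable fun ω k => e k ω := measurable_pi_lambda _ he
  have h := lintegral_le_of_indepFun
    (F := fun p : (ℕ → ℝ) × (ℕ → EuclideanSpace ℝ (Fin d)) =>
      ENNReal.ofReal ((f (iterMap (gaussianUpdate V) n 0 (fun k => (p.1 k, p.2 k))) - f 0) ^ 2))
    (B := fun _ => ENNReal.ofReal (κ ^ 2 * V.trace ^ γ)) hG hW hge
    (((hf.comp hmeas).sub measurable_const).pow_const 2).ennreal_ofReal (by
      filter_upwards [ae_forall_exists_single he helaw] with ω hω
      have ha := sub_gramSum_chainCoeff_posSemidef hV hdiag hω n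
      have h := lintegral_sq_sub_le_of_gaussianHolder hf hfH hgl hgind n _ (fun _ => 0) ha
        (by simpa [gramSum] using hV)
      simp only [WithLp.toLp_zero, smul_zero, sum_const_zero, sub_zero] at h
      simp only [iterMap_gaussianUpdate]
      refine h.trans (ENNReal.ofReal_le_ofReal (mul_le_mul_of_nonneg_left
        (Real.rpow_le_rpow ?_ ?_ hγ.le) (sq_nonneg κ)))
      · exact (posSemidef_sum _ fun k _ => posSemidef_vecMulVec_self _).trace_nonneg
      · have := ha.trace_nonneg
        rw [trace_sub] at this
        exact sub_nonneg.1 this)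
  have hm : Measurable fun ω =>
      f (iterMap (gaussianUpdate V) n 0 (fun k => (g k ω, e k ω))) - f 0 :=
    (hf.comp (hmeas.comp (hG.prodMk hW))).sub measurable_const
  have hsub : MemLp (fun ω =>
      f (iterMap (gaussianUpdate V) n 0 (fun k => (g k ω, e k ω))) - f 0) 2 P := by
    rw [memLp_two_iff_integrable_sq hm.aestronglyMeasurable]
    refine (lintegral_ofReal_ne_top_iff_integrable (hm.pow_const 2).aestronglyMeasurable
      (ae_of_all _ fun ω => sq_nonneg _)).1 (ne_top_of_le_ne_top ?_ h)
    simp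
  convert hsub.add (memLp_const (f 0)) using 1
  ext ω
  simp

end CouplingBounds

theorem mainTheorem6 {Ω : Type*} [MeasurableSpace Ω] (P : Measure Ω) [IsProbabilityMeasure P]
    {d : ℕ} (V : Matrix (Fin d) (Fin d) ℝ) (hV : V.PosDef) (hVdiag : ∀ j, V j j = 1)
    (lamMin lamMax : ℝ)
    (hlamMin : IsLeast {l : ℝ | Module.End.HasEigenvalue (Matrix.toLin' V) l} lamMin)
    (hlamMax : IsGreatest {l : ℝ | Module.End.HasEigenvalue (Matrix.toLin' V) l} lamMax)
    (e : ℤ → Ω → EuclideanSpace ℝ (Fin d)) (g : ℤ → Ω → ℝ)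
    (he : ∀ i, Measurable (e i)) (hg : ∀ i, Measurable (g i))
    (he_law : ∀ i, P.map (e i) = uniformBasisLaw d)
    (hg_law : ∀ i, P.map (g i) = gaussianReal 0 1)
    (he_indep : iIndepFun e P) (hg_indep : iIndepFun g P)
    (hge_indep : IndepFun (fun ω i => g i ω) (fun ω i => e i ω) P)
    (κ γ : ℝ) (hκ : 0 < κ) (hγ : 0 < γ) (hγ1 : γ ≤ 1)
    (f : EuclideanSpace ℝ (Fin d) → ℝ) (hf : Measurable f) (hfH : GaussianHolder V κ γ f) :
    (2 ≤ d →
      AssumptionA1 P (gaussianUpdate V) 0 (fun i ω => (g i ω, e i ω)) f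
        (gaussianRate d lamMin lamMax κ γ)) ∧
    (d = 1 →
      CouplingBound P (gaussianUpdate V) 0 (fun i ω => (g i ω, e i ω)) f
        (gaussianRate d lamMin lamMax κ γ)) := by
  have hmin := eigenvalue_pos hV hlamMin.1
  have hmax := eigenvalue_pos hV hlamMax.1
  have hcoupling (hd : 0 < d) :
      0 ≤ 1 - lamMin / d ∧ 1 - lamMin / d < 1 ∧
      CouplingBound P (gaussianUpdate V) 0 (fun i ω => (g i ω, e i ω)) f
        (gaussianRate d lamMin lamMax κ γ) := by
    have : NeZero d := ⟨hd.ne'⟩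
    have hd1 : (1 : ℝ) ≤ d := by exact_mod_cast hd
    have hle := le_one_of_mem_lowerBounds hV hVdiag hlamMin.2
    have hq : 0 ≤ 1 - lamMin / d :=
      sub_nonneg.2 (div_le_one_of_le₀ (hle.trans hd1) (by positivity))
    have hq1 : 1 - lamMin / d < 1 := sub_lt_self _ (by positivity)
    have hinj (m : ℕ) : Function.Injective fun k : ℕ => (k : ℤ) - m := fun a b h => by
      simpa using h
    have hge (m : ℕ) : IndepFun (fun ω (k : ℕ) => g ((k : ℤ) - m) ω)
        (fun ω (k : ℕ) => e ((k : ℤ) - m) ω) P :=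
      hge_indep.comp (φ := fun (u : ℤ → ℝ) (k : ℕ) => u ((k : ℤ) - m))
        (ψ := fun (u : ℤ → EuclideanSpace ℝ (Fin d)) (k : ℕ) => u ((k : ℤ) - m)) (by fun_prop) (by fun_prop)
    refine ⟨hq, hq1, ⟨fun n => ?_, gaussianRate_nonneg hq hmax.le,
      gaussianRate_antitone hq hq1.le hmax.le hγ.le,
      summable_sqrt_gaussianRate hq hq1 hmax.le hγ, fun n m => ?_⟩⟩
    · exact memLp_two_iterMap hV.posSemidef hVdiag hf hfH hγ (fun k => hg _) (fun k => he _)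
        (fun k => hg_law _) (fun k => he_law _) (hg_indep.precomp (hinj 0)) (hge 0) n
    · have h := lintegral_sq_sub_iterMap_le hV.posSemidef hVdiag hf hfH hγ hγ1
        (fun k : ℕ => hg ((k : ℤ) - m)) (fun k : ℕ => he ((k : ℤ) - m)) (fun k => hg_law _)
        (fun k => he_law _) (hg_indep.precomp (hinj m)) (he_indep.precomp (hinj m)) (hge m) n m
      -- The late chain is driven by the inputs at `(k + m) - m = k`, so it is exactly `X_n`.
      simp only [Nat.cast_add, add_sub_cancel_right] at h
      simp only [shiftedChain, add_zero, Nat.cast_zero, sub_zero]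
      refine h.trans (ENNReal.ofReal_le_ofReal ?_)
      exact mul_rpow_le_gaussianRate hq hmax.le hγ.le
        (averagedStep_iterate_posSemidef hV.posSemidef n).trace_nonneg
        (trace_averagedStep_iterate_le_geometric hV hVdiag hlamMin hlamMax n)
        (trace_averagedStep_iterate_le_harmonic hV hVdiag n)
  refine ⟨fun hd => ?_, fun hd => (hcoupling (by omega)).2.2⟩
  obtain ⟨-, hq1, hc⟩ := hcoupling (by omega)
  have : NeZero d := ⟨by omega⟩
  have hd2 : (2 : ℝ) ≤ d := by exact_mod_cast hd
  have hle := le_one_of_mem_lowerBounds hV hVdiag hlamMin.2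
  -- Here `lamMin ≤ 1 < d`; the positive ratio is what gives positivity and strict decrease.
  have hq : 0 < 1 - lamMin / d := sub_pos.2 ((div_lt_one (by positivity)).2 (by linarith))
  exact ⟨hc, gaussianRate_pos (by omega) hq hmax hκ,
    gaussianRate_strictAnti (by omega) hq hq1 hmax hκ hγ⟩
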